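/- Corollary 3.6 (Uniqueness). Let $(\Omega,\mathcal F,P)$ be a probability space, let $\mathbb K$ be $\mathbb R$ or $\mathbb C$, and let $L^0(\mathcal F,\mathbb K)$ be the algebra of almost-sure equivalence classes of $\mathbb K$-valued random variables, with $L^0(\mathcal F,\mathbb R)$ ordered almost surely and $L^0_+(\mathcal F)=\{\xi\in L^0(\mathcal F,\mathbb R):\xi\ge 0\}$. Let $S$ be a random normed module over $\mathbb K$ with base $(\Omega,\mathcal F,P)$, that is, a module over $L^0(\mathcal F,\mathbb K)$ with a map $\|\cdot\|:S\to L^0_+(\mathcal F)$ such that $\|x\|=0$ implies $x=0$, $\|\zeta x\|=|\zeta|\,\|x\|$ and $\|x+y\|\le\|x\|+\|y\|$ for all $\zeta\in L^0(\mathcal F,\mathbb K)$ and $x,y\in S$. Let $\mathcal T_{\varepsilon,\lambda}$ be the linear topology on $S$ for which the sets $\{z\in S: P\{\omega:\|z\|(\omega)<\varepsilon\}>1-\lambda\}$, $\varepsilon>0$, $0<\lambda<1$, form a local base at $0$, and suppose that $S$ is $\mathcal T_{\varepsilon,\lambda}$-complete. Let $h_1,h_2:[0,\infty)\to(S,\mathcal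 T_{\varepsilon,\lambda})$ be continuous functions with $$\|h_1(s)\|\le M_1e^{\xi_1 s}\quad\text{and}\quad\|h_2(s)\|\le M_2e^{\xi_2 s}\qquad\text{for all } s\ge 0,$$ for some $M_1,M_2\in L^0_+(\mathcal F)$ and $\xi_1,\xi_2\in L^0(\mathcal F,\mathbb R)$. If $$\int_0^\infty e^{-\eta s}h_1(s)\,ds=\int_0^\infty e^{-\eta s}h_2(s)\,ds$$ for every $\eta\in L^0(\mathcal F,\mathbb R)$ with $\eta>\xi_1\vee\xi_2$ almost surely on $\Omega$, then $h_1=h_2$. Here $\int_0^\infty$ is the improper Riemann integral, i.e. the $\mathcal T_{\varepsilon,\lambda}$-limit, as $L\to\infty$, of the Riemann integrals over $[0,L]$, which are $\mathcal T_{\varepsilon,\lambda}$-limits of Riemann sums. -/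

import Mathlib

open MeasureTheory Filter Topology
open scoped NNReal

/-! ## The algebra `L⁰(𝓕, R)`

`Ω →ₘ[P] R` is the set of equivalence classes of measurable `R`-valued random variables; Mathlib
provides its pointwise (a.e.) addition, multiplication and order. -/

section L0

variable {Ω : Type*} [MeasurableSpace Ω] {P : Measure Ω}

/-- `L⁰(𝓕, R)` is a commutative ring under the pointwise (a.e.) operations. -/
noncomputable instance AEEqFun.instCommRingL0 {R : Type*} [TopologicalSpace R] [CommRing R]
    [IsTopologicalRing R] : CommRing (Ω →ₘ[P] R) :=
  { (inferInstance : AddCommGroup (Ω →ₘ[P] R)), (inferInstance : CommMonoid (Ω →ₘ[P] R)) with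
    left_distrib := fun f g k => by
      apply AEEqFun.ext
      filter_upwards [AEEqFun.coeFn_mul f (g + k), AEEqFun.coeFn_add g k,
        AEEqFun.coeFn_add (f * g) (f * k), AEEqFun.coeFn_mul f g, AEEqFun.coeFn_mul f k]
        with ω h1 h2 h3 h4 h5
      simp only [Pi.mul_apply, Pi.add_apply] at h1 h2 h3 h4 h5
      rw [h1, h2, h3, h4, h5, mul_add]
    right_distrib := fun f g k => by
      apply AEEqFun.ext
      filter_upwards [AEEqFun.coeFn_mul (f + g) k, AEEqFun.coeFn_add f g,
        AEEqFun.coeFn_add (f * k) (g * k), AEEqFun.coeFn_mul f k, AEEqFun.coeFn_mul g k]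
        with ω h1 h2 h3 h4 h5
      simp only [Pi.mul_apply, Pi.add_apply] at h1 h2 h3 h4 h5
      rw [h1, h2, h3, h4, h5, add_mul]
    zero_mul := fun f => by
      apply AEEqFun.ext
      filter_upwards [AEEqFun.coeFn_mul 0 f, AEEqFun.coeFn_zero (μ := P) (α := Ω) (β := R)]
        with ω h1 h2
      simp only [Pi.mul_apply, Pi.zero_apply] at h1 h2
      rw [h1, h2, zero_mul]
    mul_zero := fun f => by
      apply AEEqFun.ext
      filter_upwards [AEEqFun.coeFn_mul f 0, AEEqFun.coeFn_zero (μ := P) (α := Ω) (β := R)]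
        with ω h1 h2
      simp only [Pi.mul_apply, Pi.zero_apply] at h1 h2
      rw [h1, h2, mul_zero] }

/-- The absolute value `|ζ| ∈ L⁰(𝓕, ℝ)` of `ζ ∈ L⁰(𝓕, 𝕂)`. -/
noncomputable def L0abs {𝕜 : Type*} [RCLike 𝕜] (ζ : Ω →ₘ[P] 𝕜) : Ω →ₘ[P] ℝ :=
  AEEqFun.comp (fun z : 𝕜 => ‖z‖) continuous_norm ζ

/-- The class `e^{ξ s} ∈ L⁰(𝓕, 𝕂)` of `ω ↦ exp (ξ(ω) s)`, for `ξ ∈ L⁰(𝓕, ℝ)` and `s ∈ ℝ`. -/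
noncomputable def L0exp (𝕜 : Type*) [RCLike 𝕜] (ξ : Ω →ₘ[P] ℝ) (s : ℝ) : Ω →ₘ[P] 𝕜 :=
  AEEqFun.comp (fun x : ℝ => ((Real.exp (x * s) : ℝ) : 𝕜)) (by fun_prop) ξ

end L0

/-! ## Random normed modules -/

/-- An `L⁰`-norm on a module `S` over the algebra `L⁰(𝓕, 𝕂)`: it makes `S` a random normed module
over `𝕂` with base `(Ω, 𝓕, P)`. -/
class RNModule (𝕜 : Type*) [RCLike 𝕜] {Ω : Type*} [MeasurableSpace Ω] (P : Measure Ω)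
    (S : Type*) [AddCommGroup S] [Module (Ω →ₘ[P] 𝕜) S] where
  /-- The `L⁰`-norm. -/
  l0norm : S → (Ω →ₘ[P] ℝ)
  l0norm_nonneg : ∀ x, 0 ≤ l0norm x
  eq_zero_of_l0norm_eq_zero : ∀ x, l0norm x = 0 → x = 0
  l0norm_smul : ∀ (ζ : Ω →ₘ[P] 𝕜) (x : S), l0norm (ζ • x) = L0abs ζ * l0norm x
  l0norm_add_le : ∀ x y, l0norm (x + y) ≤ l0norm x + l0norm y

namespace RNModule

variable (𝕜 : Type*) [RCLike 𝕜] {Ω : Type*} [MeasurableSpace Ω] (P : Measure Ω)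
  {S : Type*} [AddCommGroup S] [Module (Ω →ₘ[P] 𝕜) S] [RNModule 𝕜 P S]

/-- `U_θ(ε, λ) = {z | P{ω | ‖z‖(ω) < ε} > 1 - λ}`. -/
def nhd (S : Type*) [AddCommGroup S] [Module (Ω →ₘ[P] 𝕜) S] [RNModule 𝕜 P S]
    (ε lam : ℝ) : Set S :=
  {z | 1 - lam < P.real {ω | (l0norm 𝕜 (P := P) z : Ω →ₘ[P] ℝ) ω < ε}}

theorem l0norm_zero : l0norm 𝕜 (P := P) (0 : S) = 0 := by
  have h := l0norm_smul (𝕜 := 𝕜) (P := P) (0 : Ω →ₘ[P] 𝕜) (0 : S)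
  rw [smul_zero] at h
  rw [h]
  apply AEEqFun.ext
  filter_upwards [AEEqFun.coeFn_mul (L0abs (0 : Ω →ₘ[P] 𝕜)) (l0norm 𝕜 (P := P) (0 : S)),
    AEEqFun.coeFn_comp (fun z : 𝕜 => ‖z‖) continuous_norm (0 : Ω →ₘ[P] 𝕜),
    AEEqFun.coeFn_zero (μ := P) (α := Ω) (β := 𝕜),
    AEEqFun.coeFn_zero (μ := P) (α := Ω) (β := ℝ)] with ω h1 h2 h3 h4
  simp only [Pi.mul_apply, Pi.zero_apply, Function.comp_apply] at h1 h2 h3 h4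
  rw [h1, L0abs, h2, h3, h4, norm_zero, zero_mul]

theorem l0norm_neg (x : S) : l0norm 𝕜 (P := P) (-x) = l0norm 𝕜 (P := P) x := by
  have h := l0norm_smul (𝕜 := 𝕜) (P := P) (-1 : Ω →ₘ[P] 𝕜) x
  rw [neg_smul, one_smul] at h
  rw [h]
  apply AEEqFun.ext
  filter_upwards [AEEqFun.coeFn_mul (L0abs (-1 : Ω →ₘ[P] 𝕜)) (l0norm 𝕜 (P := P) x),
    AEEqFun.coeFn_comp (fun z : 𝕜 => ‖z‖) continuous_norm (-1 : Ω →ₘ[P] 𝕜),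
    AEEqFun.coeFn_neg (1 : Ω →ₘ[P] 𝕜),
    AEEqFun.coeFn_one (μ := P) (α := Ω) (β := 𝕜)] with ω h1 h2 h3 h4
  simp only [Pi.mul_apply, Pi.neg_apply, Pi.one_apply, Function.comp_apply] at h1 h2 h3 h4
  rw [h1, L0abs, h2, h3, h4, norm_neg, norm_one, one_mul]

variable [IsProbabilityMeasure P]

/-- The sets `U_θ(ε, λ)`, `ε > 0`, `0 < λ < 1`, form a basis of neighbourhoods of the null element
for a group topology on `S`. -/
@[reducible]
def basis (S : Type*) [AddCommGroup S] [Module (Ω →ₘ[P] 𝕜) S] [RNModule 𝕜 P S] :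
    AddGroupFilterBasis S :=
  addGroupFilterBasisOfComm
    {U | ∃ ε lam : ℝ, 0 < ε ∧ 0 < lam ∧ lam < 1 ∧ U = nhd 𝕜 P S ε lam}
    ⟨_, 1, 1 / 2, by norm_num, by norm_num, by norm_num, rfl⟩
    (by
      rintro _ _ ⟨ε, l, hε, hl, hl1, rfl⟩ ⟨ε', l', hε', hl', hl1', rfl⟩
      refine ⟨_, ⟨min ε ε', min l l', lt_min hε hε', lt_min hl hl', min_lt_of_left_lt hl1, rfl⟩,
        fun z hz => ⟨?_, ?_⟩⟩
      · refine lt_of_le_of_lt (by linarith [min_le_left l l'])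
          (lt_of_lt_of_le hz (measureReal_mono fun ω hω => ?_))
        have hω' : (l0norm 𝕜 (P := P) z : Ω →ₘ[P] ℝ) ω < min ε ε' := hω
        exact lt_of_lt_of_le hω' (min_le_left ε ε')
      · refine lt_of_le_of_lt (by linarith [min_le_right l l'])
          (lt_of_lt_of_le hz (measureReal_mono fun ω hω => ?_))
        have hω' : (l0norm 𝕜 (P := P) z : Ω →ₘ[P] ℝ) ω < min ε ε' := hω
        exact lt_of_lt_of_le hω' (min_le_right ε ε'))
    (by
      rintro _ ⟨ε, l, hε, hl, hl1, rfl⟩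
      have h : P.real {ω | (l0norm 𝕜 (P := P) (0 : S) : Ω →ₘ[P] ℝ) ω < ε} = 1 := by
        rw [l0norm_zero, ← probReal_univ (μ := P)]
        refine measureReal_congr ?_
        filter_upwards [AEEqFun.coeFn_zero (μ := P) (α := Ω) (β := ℝ)] with ω hω
        have : (0 : Ω →ₘ[P] ℝ) ω < ε := by rw [hω]; exact hε
        exact eq_true this
      change 1 - l < _
      rw [h]
      linarith)
    (by
      rintro _ ⟨ε, l, hε, hl, hl1, rfl⟩
      refine ⟨_, ⟨ε / 2, l / 2, by linarith, by linarith, by linarith, rfl⟩, ?_⟩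
      rintro _ ⟨x, hx, y, hy, rfl⟩
      have key : P.real ({ω | (l0norm 𝕜 (P := P) x : Ω →ₘ[P] ℝ) ω < ε / 2} ∩
          {ω | (l0norm 𝕜 (P := P) y : Ω →ₘ[P] ℝ) ω < ε / 2}) ≤
          P.real {ω | (l0norm 𝕜 (P := P) (x + y) : Ω →ₘ[P] ℝ) ω < ε} := by
        rw [measureReal_def, measureReal_def]
        refine ENNReal.toReal_mono (measure_ne_top _ _) (measure_mono_ae ?_)
        filter_upwards [AEEqFun.coeFn_le.2 (l0norm_add_le (𝕜 := 𝕜) (P := P) x y),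
          AEEqFun.coeFn_add (l0norm 𝕜 (P := P) x) (l0norm 𝕜 (P := P) y)] with ω h1 h2 h3
        have h3' : (l0norm 𝕜 (P := P) x : Ω →ₘ[P] ℝ) ω < ε / 2 ∧
          (l0norm 𝕜 (P := P) y : Ω →ₘ[P] ℝ) ω < ε / 2 := h3
        rw [h2, Pi.add_apply] at h1
        change (l0norm 𝕜 (P := P) (x + y) : Ω →ₘ[P] ℝ) ω < ε
        linarith [h3'.1, h3'.2]
      have hm : MeasurableSet {ω | (l0norm 𝕜 (P := P) y : Ω →ₘ[P] ℝ) ω < ε / 2} :=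
        measurableSet_lt (l0norm 𝕜 (P := P) y).measurable measurable_const
      have hu := measureReal_union_add_inter (μ := P)
        (s := {ω | (l0norm 𝕜 (P := P) x : Ω →ₘ[P] ℝ) ω < ε / 2}) hm
      have h1 : P.real ({ω | (l0norm 𝕜 (P := P) x : Ω →ₘ[P] ℝ) ω < ε / 2} ∪
          {ω | (l0norm 𝕜 (P := P) y : Ω →ₘ[P] ℝ) ω < ε / 2}) ≤ 1 := measureReal_le_one
      have hx' : 1 - l / 2 < P.real {ω | (l0norm 𝕜 (P := P) x : Ω →ₘ[P] ℝ) ω < ε / 2} := hx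
      have hy' : 1 - l / 2 < P.real {ω | (l0norm 𝕜 (P := P) y : Ω →ₘ[P] ℝ) ω < ε / 2} := hy
      change 1 - l < _
      linarith)
    (by
      rintro _ ⟨ε, l, hε, hl, hl1, rfl⟩
      refine ⟨_, ⟨ε, l, hε, hl, hl1, rfl⟩, fun z hz => ?_⟩
      change 1 - l < _
      rw [l0norm_neg]
      exact hz)

/-- The `(ε, λ)`-topology on `S`. -/
@[reducible]
def epsLamTopology (S : Type*) [AddCommGroup S] [Module (Ω →ₘ[P] 𝕜) S] [RNModule 𝕜 P S] :
    TopologicalSpace S :=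
  (basis 𝕜 P S).topology

/-- The translation invariant uniform structure of the `(ε, λ)`-topology. -/
@[reducible]
def epsLamUniformSpace (S : Type*) [AddCommGroup S] [Module (Ω →ₘ[P] 𝕜) S] [RNModule 𝕜 P S] :
    UniformSpace S :=
  @IsTopologicalAddGroup.rightUniformSpace S _ (epsLamTopology 𝕜 P S)
    (basis 𝕜 P S).isTopologicalAddGroup

/-- `S` is complete for the `(ε, λ)`-topology. -/
def EpsLamComplete (S : Type*) [AddCommGroup S] [Module (Ω →ₘ[P] 𝕜) S] [RNModule 𝕜 P S] : Prop :=
  @CompleteSpace S (epsLamUniformSpace 𝕜 P S)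

end RNModule

/-! ## Riemann integrals and the Laplace transform -/

/-- A tagged partition `a = pt 0 < pt 1 < ⋯ < pt n = b` with tags `tag i ∈ [pt i, pt (i + 1)]`.
(The values `pt i` for `i > n` and `tag i` for `i ≥ n` are irrelevant.) -/
structure TaggedPartition (a b : ℝ) where
  n : ℕ
  pt : ℕ → ℝ
  tag : ℕ → ℝ
  pt_zero : pt 0 = a
  pt_last : pt n = b
  pt_lt : ∀ i < n, pt i < pt (i + 1)
  tag_mem : ∀ i < n, tag i ∈ Set.Icc (pt i) (pt (i + 1))

namespace RNModule

variable (𝕜 : Type*) [RCLike 𝕜] {Ω : Type*} [MeasurableSpace Ω] (P : Measure Ω)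
  {S : Type*} [AddCommGroup S] [Module (Ω →ₘ[P] 𝕜) S]

/-- The Riemann sum `∑ᵢ (pt (i + 1) - pt i) g(tag i)`; a real number acts on `S` as a constant
element of `L⁰(𝓕, 𝕂)`. -/
noncomputable def riemannSum {a b : ℝ} (π : TaggedPartition a b) (g : ℝ → S) : S :=
  ∑ i ∈ Finset.range π.n,
    (AEEqFun.const Ω (((π.pt (i + 1) - π.pt i : ℝ)) : 𝕜) : Ω →ₘ[P] 𝕜) • g (π.tag i)

variable [RNModule 𝕜 P S]

/-- `g` is Riemann integrable on `[a, b]` with integral `I`: the Riemann sums converge to `I` in the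
`(ε, λ)`-topology as the mesh tends to `0`. -/
def HasRiemannIntegral (g : ℝ → S) (a b : ℝ) (I : S) : Prop :=
  ∀ ε lam : ℝ, 0 < ε → 0 < lam → lam < 1 → ∃ δ > 0, ∀ π : TaggedPartition a b,
    (∀ i < π.n, π.pt (i + 1) - π.pt i < δ) → riemannSum 𝕜 P π g - I ∈ nhd 𝕜 P S ε lam

variable [IsProbabilityMeasure P]

/-- `∫₀^∞ g(s) ds = I`: `g` is Riemann integrable on each `[0, L]`, and `∫₀^L g(s) ds` converges to
`I` in the `(ε, λ)`-topology as `L → ∞`. -/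
def HasImproperIntegral (g : ℝ → S) (I : S) : Prop :=
  ∃ J : ℝ → S, (∀ L, 0 ≤ L → HasRiemannIntegral 𝕜 P g 0 L (J L)) ∧
    Tendsto J atTop (@nhds S (epsLamTopology 𝕜 P S) I)

open Classical in
/-- The improper Riemann integral `∫₀^∞ g(s) ds` (with value `0` if it does not exist). -/
noncomputable def improperIntegral (g : ℝ → S) : S :=
  if H : ∃ I, HasImproperIntegral 𝕜 P g I then H.choose else 0

/-- The Laplace transform `H(η) = ∫₀^∞ e^{-η s} h(s) ds` of `h : [0, ∞) → S`. Only the values of the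
integrand at `s ≥ 0` enter. -/
noncomputable def laplaceTransform (h : ℝ≥0 → S) (η : Ω →ₘ[P] ℝ) : S :=
  improperIntegral 𝕜 P fun s : ℝ => L0exp 𝕜 (-η) s • h s.toNNReal

end RNModule

/-! The `(ε, λ)`-topology is in general not locally convex, so vector integration in `S` is replaced
by Bochner integration in a Banach space inside `S`. Put `M = M₁ + M₂` and `ξ = ξ₁ ⊔ ξ₂`. The damped
functions `e^{-ξs} h(s)` have `L⁰`-norm at most `M`, hence weighted norm `E[‖x‖ / (1 + |M|)]` at
most 1. The elements of finite weighted norm form a real Banach space `weightedL1`: completeness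
comes from that of `S` and Fatou's lemma (`completeSpace_weightedL1`), and its inclusion into `S` is
continuous (`exists_forall_norm_lt_mem_nhd`). The damped functions are norm continuous by dominated
convergence (`continuous_damped`).

For a real constant `c > 0`, `e^{-(ξ + c)s} h(s)` is the scalar `e^{-cs}` times the damped function,
so the Laplace transform at `ξ + c` exists and is a Bochner integral (`laplaceTransform_add_const`).
Only `c = 1, 2, …` are needed: if `F` is `e^{-s}` times the difference of the damped functions,
every `∫ e^{-ks} F(s) ds` vanishes. By Weierstrass approximation in `x = e^{-s}`, `∫ φ(e^{-s}) F(s)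
ds = 0` for all continuous `φ`, which includes all test functions on `(0, ∞)`. Hence `F = 0`, and
dividing by `e^{-s}` and by `e^{-ξs}` gives `h₁ = h₂`. -/

section BanachValued

variable {E : Type*} [NormedAddCommGroup E] [NormedSpace ℝ E]

/-! ### Tagged partitions and Riemann sums in Banach spaces -/

theorem TaggedPartition.left_le_pt {a b : ℝ} (π : TaggedPartition a b) {i : ℕ} (hi : i ≤ π.n) :
    a ≤ π.pt i := by
  induction i with
  | zero => exact π.pt_zero.ge
  | succ k ih => exact (ih (by omega)).trans (π.pt_lt k (by omega)).le

theorem TaggedPartition.pt_le_right {a b : ℝ} (π : TaggedPartition a b) {i : ℕ} (hi : i ≤ π.n) :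
    π.pt i ≤ b := by
  induction hi using Nat.decreasingInduction with
  | self => exact π.pt_last.le
  | of_succ k hk ih => exact (π.pt_lt k hk).le.trans ih

theorem TaggedPartition.left_le_tag {a b : ℝ} (π : TaggedPartition a b) {i : ℕ} (hi : i < π.n) :
    a ≤ π.tag i :=
  (π.left_le_pt hi.le).trans (π.tag_mem i hi).1

theorem TaggedPartition.tag_le_right {a b : ℝ} (π : TaggedPartition a b) {i : ℕ} (hi : i < π.n) :
    π.tag i ≤ b :=
  (π.tag_mem i hi).2.trans (π.pt_le_right hi)

/-- Tagged partitions of arbitrarily small mesh exist. -/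
theorem TaggedPartition.exists_mesh_lt {a b : ℝ} (hab : a ≤ b) {δ : ℝ} (hδ : 0 < δ) :
    ∃ π : TaggedPartition a b, ∀ i < π.n, π.pt (i + 1) - π.pt i < δ := by
  rcases hab.eq_or_lt with rfl | hab
  · exact ⟨⟨0, fun _ => a, fun _ => a, rfl, rfl, by simp, by simp⟩, by simp⟩
  · obtain ⟨N, hN⟩ := exists_nat_gt ((b - a) / δ)
    have hN0 : (0 : ℝ) < N := (div_pos (sub_pos.2 hab) hδ).trans hN
    have hstep : ∀ i : ℕ, (a + (i + 1 : ℕ) * ((b - a) / N)) - (a + i * ((b - a) / N)) =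
        (b - a) / N := fun i => by push_cast; ring
    have hpos : 0 < (b - a) / N := div_pos (sub_pos.2 hab) hN0
    refine ⟨⟨N, fun i => a + i * ((b - a) / N), fun i => a + i * ((b - a) / N), by simp, ?_,
      fun i _ => ?_, fun i _ => ⟨le_rfl, ?_⟩⟩, fun i _ => ?_⟩
    · field_simp; ring
    · linarith [hstep i]
    · linarith [hstep i]
    · change (a + (i + 1 : ℕ) * ((b - a) / N)) - (a + i * ((b - a) / N)) < δ
      rw [hstep, div_lt_iff₀ hN0]
      rwa [div_lt_iff₀ hδ, mul_comm] at hN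

/-- Riemann sums of a continuous Banach space valued function converge to its Bochner integral. -/
theorem exists_forall_norm_riemannSum_sub_integral_lt [CompleteSpace E] {v : ℝ → E}
    (hv : Continuous v) {a b : ℝ} (hab : a ≤ b) {ε : ℝ} (hε : 0 < ε) :
    ∃ δ > 0, ∀ π : TaggedPartition a b, (∀ i < π.n, π.pt (i + 1) - π.pt i < δ) →
      ‖∑ i ∈ Finset.range π.n, (π.pt (i + 1) - π.pt i) • v (π.tag i) - ∫ s in a..b, v s‖ < ε := by
  -- The extra 1 covers the degenerate interval `a = b`.
  have hb : 0 < b - a + 1 := by linarith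
  obtain ⟨δ, hδ, hu⟩ := Metric.uniformContinuousOn_iff.1
    (isCompact_Icc.uniformContinuousOn_of_continuous (s := Set.Icc a b) hv.continuousOn)
    (ε / (b - a + 1)) (div_pos hε hb)
  refine ⟨δ, hδ, fun π hπ => ?_⟩
  have hsum : ∫ s in a..b, v s =
      ∑ i ∈ Finset.range π.n, ∫ s in (π.pt i)..(π.pt (i + 1)), v s := by
    rw [intervalIntegral.sum_integral_adjacent_intervals
      fun k _ => hv.intervalIntegrable _ _, π.pt_zero, π.pt_last]
  have hterm : ∀ i ∈ Finset.range π.n,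
      ‖(π.pt (i + 1) - π.pt i) • v (π.tag i) - ∫ s in (π.pt i)..(π.pt (i + 1)), v s‖ ≤
        ε / (b - a + 1) * (π.pt (i + 1) - π.pt i) := by
    intro i hi
    have hi := Finset.mem_range.1 hi
    have hlt := π.pt_lt i hi
    rw [← intervalIntegral.integral_const, ← intervalIntegral.integral_sub
      (continuous_const.intervalIntegrable _ _) (hv.intervalIntegrable _ _)]
    refine (intervalIntegral.norm_integral_le_of_norm_le_const (C := ε / (b - a + 1))
      fun s hs => ?_).trans (by rw [abs_of_pos (sub_pos.2 hlt)])
    rw [Set.uIoc_of_le hlt.le] at hs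
    have htag := π.tag_mem i hi
    have hδi := hπ i hi
    rw [← dist_eq_norm]
    refine (hu _ ⟨π.left_le_tag hi, π.tag_le_right hi⟩ _
      ⟨(π.left_le_pt hi.le).trans hs.1.le, hs.2.trans (π.pt_le_right hi)⟩ ?_).le
    rw [Real.dist_eq, abs_lt]
    constructor <;> linarith [hs.1, hs.2, htag.1, htag.2]
  rw [hsum, ← Finset.sum_sub_distrib]
  calc _ ≤ ∑ i ∈ Finset.range π.n, ε / (b - a + 1) * (π.pt (i + 1) - π.pt i) :=
        norm_sum_le_of_le _ hterm
    _ = ε / (b - a + 1) * (b - a) := by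
        rw [← Finset.mul_sum, Finset.sum_range_sub, π.pt_zero, π.pt_last]
    _ < ε := by
        rw [div_mul_eq_mul_div, div_lt_iff₀ hb]
        nlinarith

/-! ### Uniqueness of the Laplace transform in Banach spaces -/

/-- For `s > 0` the argument `e^{-s}` stays in `[0, 1]`, where `φ` is bounded. -/
theorem integrableOn_comp_exp_neg_smul {F : ℝ → E} (hi : IntegrableOn F (Set.Ioi 0))
    {φ : ℝ → ℝ} (hφ : Continuous φ) :
    IntegrableOn (fun s => φ (Real.exp (-s)) • F s) (Set.Ioi 0) := by
  obtain ⟨C, hC⟩ := (isCompact_Icc (a := (0 : ℝ)) (b := 1)).exists_bound_of_continuousOn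
    hφ.continuousOn
  refine Integrable.mono' (hi.norm.const_mul C)
    ((hφ.comp (by fun_prop)).aestronglyMeasurable.smul hi.aestronglyMeasurable) ?_
  filter_upwards [ae_restrict_mem measurableSet_Ioi] with s hs
  rw [norm_smul]
  refine mul_le_mul_of_nonneg_right (hC _ ⟨(Real.exp_pos _).le, ?_⟩) (norm_nonneg _)
  exact Real.exp_le_one_iff.2 (by linarith [Set.mem_Ioi.1 hs])

theorem integral_polynomial_exp_neg_smul_eq_zero {F : ℝ → E} (hi : IntegrableOn F (Set.Ioi 0))
    (h : ∀ k : ℕ, ∫ s in Set.Ioi (0 : ℝ), Real.exp (-s) ^ k • F s = 0) (p : Polynomial ℝ) :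
    ∫ s in Set.Ioi (0 : ℝ), p.eval (Real.exp (-s)) • F s = 0 := by
  induction p using Polynomial.induction_on' with
  | add p q hp hq =>
    simp only [Polynomial.eval_add, add_smul]
    rw [integral_add (integrableOn_comp_exp_neg_smul hi p.continuous)
      (integrableOn_comp_exp_neg_smul hi q.continuous), hp, hq, add_zero]
  | monomial n a =>
    simp only [Polynomial.eval_monomial, mul_smul]
    rw [integral_smul, h, smul_zero]

/-- Weierstrass: a polynomial within `ε / (C + 1)` of `φ` on `[0, 1]`, with `C = ∫ ‖F‖`, changes the
integral by at most `ε`. -/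
theorem integral_comp_exp_neg_smul_eq_zero {F : ℝ → E} (hi : IntegrableOn F (Set.Ioi 0))
    (h : ∀ k : ℕ, ∫ s in Set.Ioi (0 : ℝ), Real.exp (-s) ^ k • F s = 0)
    {φ : ℝ → ℝ} (hφ : Continuous φ) :
    ∫ s in Set.Ioi (0 : ℝ), φ (Real.exp (-s)) • F s = 0 := by
  rw [← norm_le_zero_iff]
  refine le_of_forall_pos_le_add fun ε hε => ?_
  set C := ∫ s in Set.Ioi (0 : ℝ), ‖F s‖
  have hC : 0 ≤ C := integral_nonneg fun _ => norm_nonneg _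
  obtain ⟨p, hp⟩ := exists_polynomial_near_of_continuousOn 0 1 φ hφ.continuousOn (ε / (C + 1))
    (div_pos hε (by linarith))
  have hsub : ∫ s in Set.Ioi (0 : ℝ), φ (Real.exp (-s)) • F s =
      ∫ s in Set.Ioi (0 : ℝ), (φ (Real.exp (-s)) • F s - p.eval (Real.exp (-s)) • F s) := by
    rw [integral_sub (integrableOn_comp_exp_neg_smul hi hφ)
      (integrableOn_comp_exp_neg_smul hi p.continuous),
      integral_polynomial_exp_neg_smul_eq_zero hi h p, sub_zero]
  rw [hsub]
  calc _ ≤ ∫ s in Set.Ioi (0 : ℝ), ε / (C + 1) * ‖F s‖ := by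
        refine norm_integral_le_of_norm_le (hi.norm.const_mul _) ?_
        filter_upwards [ae_restrict_mem measurableSet_Ioi] with s hs
        rw [← sub_smul, norm_smul]
        refine mul_le_mul_of_nonneg_right ?_ (norm_nonneg _)
        rw [Real.norm_eq_abs, abs_sub_comm]
        exact (hp _ ⟨(Real.exp_pos _).le,
          Real.exp_le_one_iff.2 (by linarith [Set.mem_Ioi.1 hs])⟩).le
    _ = ε / (C + 1) * C := integral_const_mul _ _
    _ ≤ 0 + ε := by
        rw [div_mul_eq_mul_div, div_le_iff₀ (by linarith)]
        nlinarith

/-- A compactly supported continuous function on `(0, ∞)` is a continuous function of `e^{-s}`. -/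
theorem continuous_comp_neg_log {g : ℝ → ℝ} (hg : Continuous g) (hc : HasCompactSupport g)
    (h0 : g 0 = 0) : Continuous fun x => g (-Real.log x) := by
  rw [continuous_iff_continuousAt]
  intro x
  by_cases hx : x = 0
  · subst hx
    -- Near `x = 0`, on both sides because `log x = log |x|`, the point `-log x` leaves the support
    -- of `g`. At `x = 0` itself `log 0 = 0`, and `h0` supplies the right value.
    have hlim : Tendsto (fun x => -Real.log x) (𝓝[≠] 0) (cocompact ℝ) :=
      (tendsto_neg_atBot_atTop.comp Real.tendsto_log_nhdsNE_zero).mono_right atTop_le_cocompact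
    have hev : ∀ᶠ x in 𝓝[≠] (0 : ℝ), g (-Real.log x) = 0 :=
      hlim.eventually (coclosedCompact_eq_cocompact (X := ℝ) ▸
        hasCompactSupport_iff_eventuallyEq.1 hc)
    have : ∀ᶠ x in 𝓝 (0 : ℝ), g (-Real.log x) = 0 := by
      rw [eventually_nhdsWithin_iff] at hev
      filter_upwards [hev] with x hx
      by_cases h : x = 0
      · simp [h, h0]
      · exact hx h
    exact continuousAt_const.congr (this.mono fun _ h => h.symm)
  · exact (hg.comp continuous_neg).continuousAt.comp (Real.continuousAt_log hx)

/-- Uniqueness of the Laplace transform of continuous Banach space valued functions. -/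
theorem eq_zero_of_forall_integral_exp_smul_eq_zero [CompleteSpace E] {F : ℝ → E}
    (hF : Continuous F) (hi : IntegrableOn F (Set.Ioi 0))
    (h : ∀ k : ℕ, ∫ s in Set.Ioi (0 : ℝ), Real.exp (-s) ^ k • F s = 0) {s : ℝ} (hs : 0 ≤ s) :
    F s = 0 := by
  have hae : ∀ᵐ s, s ∈ Set.Ioi (0 : ℝ) → F s = 0 := by
    refine isOpen_Ioi.ae_eq_zero_of_integral_contDiff_smul_eq_zero
      (hF.locallyIntegrable.locallyIntegrableOn _) fun g hg hgc hgs => ?_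
    have hg0 : ∀ x, x ∉ Set.Ioi (0 : ℝ) → g x = 0 := fun x hx =>
      image_eq_zero_of_notMem_tsupport fun hx' => hx (hgs hx')
    -- With `φ(x) = g(-log x)` one has `φ(e^{-s}) = g(s)`.
    have key := integral_comp_exp_neg_smul_eq_zero hi h
      (continuous_comp_neg_log hg.continuous hgc (hg0 0 (by simp)))
    simp only [Real.log_exp, neg_neg] at key
    rwa [setIntegral_eq_integral_of_forall_compl_eq_zero
      fun x hx => by rw [hg0 x hx, zero_smul]] at key
  have hpos : Set.EqOn F (fun _ => 0) (Set.Ioi 0) :=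
    Measure.eqOn_open_of_ae_eq ((ae_restrict_iff' measurableSet_Ioi).2 hae) isOpen_Ioi
      hF.continuousOn continuousOn_const
  have := hpos.closure hF continuous_const
  rw [closure_Ioi] at this
  exact this hs

theorem integrableOn_exp_smul_of_bounded {v : ℝ → E} (hv : Continuous v) {C : ℝ}
    (hC : ∀ s, ‖v s‖ ≤ C) {c : ℝ} (hc : 0 < c) :
    IntegrableOn (fun s => Real.exp (-(c * s)) • v s) (Set.Ioi 0) := by
  have hcont : Continuous fun s => Real.exp (-(c * s)) • v s := by fun_prop
  refine Integrable.mono' (((integrableOn_exp_mul_Ioi (a := -c) (by linarith) 0)).mul_const C)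
    (hcont.locallyIntegrable.aestronglyMeasurable.restrict) (Eventually.of_forall fun s => ?_)
  rw [norm_smul, Real.norm_of_nonneg (Real.exp_pos _).le, neg_mul]
  exact mul_le_mul_of_nonneg_left (hC s) (Real.exp_pos _).le

end BanachValued

/-! ### Exponentials and real constants in `L⁰` -/

section L0

variable {Ω : Type*} [MeasurableSpace Ω] {P : Measure Ω}

theorem coeFn_L0abs {𝕜 : Type*} [RCLike 𝕜] (ζ : Ω →ₘ[P] 𝕜) :
    L0abs ζ =ᵐ[P] fun ω => ‖ζ ω‖ :=
  AEEqFun.coeFn_comp _ continuous_norm ζ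

theorem coeFn_L0exp (𝕜 : Type*) [RCLike 𝕜] (ξ : Ω →ₘ[P] ℝ) (s : ℝ) :
    L0exp 𝕜 ξ s =ᵐ[P] fun ω => ((Real.exp (ξ ω * s) : ℝ) : 𝕜) :=
  AEEqFun.coeFn_comp _ (by fun_prop) ξ

/-- Separates the real kernel `e^{-cs}` from the random factor `e^{-ξs}`, which is absorbed into the
damped function. -/
theorem L0exp_neg_add_const (𝕜 : Type*) [RCLike 𝕜] (ξ : Ω →ₘ[P] ℝ) (c s : ℝ) :
    L0exp 𝕜 (-(ξ + AEEqFun.const Ω c)) s =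
      AEEqFun.const Ω ((Real.exp (-(c * s)) : ℝ) : 𝕜) * L0exp 𝕜 (-ξ) s := by
  apply AEEqFun.ext
  filter_upwards [coeFn_L0exp 𝕜 (-(ξ + AEEqFun.const Ω c)) s, coeFn_L0exp 𝕜 (-ξ) s,
    AEEqFun.coeFn_neg (ξ + AEEqFun.const Ω c), AEEqFun.coeFn_neg ξ,
    AEEqFun.coeFn_add ξ (AEEqFun.const Ω c), AEEqFun.coeFn_const Ω (μ := P) c,
    AEEqFun.coeFn_mul (AEEqFun.const Ω ((Real.exp (-(c * s)) : ℝ) : 𝕜)) (L0exp 𝕜 (-ξ) s),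
    AEEqFun.coeFn_const Ω (μ := P) ((Real.exp (-(c * s)) : ℝ) : 𝕜)] with ω h1 h2 h3 h4 h5 h6 h7 h8
  rw [h1, h7, Pi.mul_apply, h8, h2, h3, h4, Pi.neg_apply, Pi.neg_apply, h5, Pi.add_apply, h6,
    Function.const_apply, Function.const_apply, ← RCLike.ofReal_mul, ← Real.exp_add]
  congr 2
  ring

theorem L0exp_mul_L0exp_neg (𝕜 : Type*) [RCLike 𝕜] (ξ : Ω →ₘ[P] ℝ) (s : ℝ) :
    L0exp 𝕜 ξ s * L0exp 𝕜 (-ξ) s = 1 := by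
  apply AEEqFun.ext
  filter_upwards [coeFn_L0exp 𝕜 ξ s, coeFn_L0exp 𝕜 (-ξ) s, AEEqFun.coeFn_neg ξ,
    AEEqFun.coeFn_mul (L0exp 𝕜 ξ s) (L0exp 𝕜 (-ξ) s),
    AEEqFun.coeFn_one (μ := P) (α := Ω) (β := 𝕜)] with ω h1 h2 h3 h4 h5
  rw [h4, Pi.mul_apply, h1, h2, h3, h5, Pi.neg_apply, Pi.one_apply, ← RCLike.ofReal_mul,
    ← Real.exp_add]
  simp

/-- The embedding of the real numbers into `L⁰(𝓕, 𝕂)` as constants. -/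
noncomputable def realToL0 (𝕜 : Type*) [RCLike 𝕜] (P : Measure Ω) : ℝ →+* (Ω →ₘ[P] 𝕜) where
  toFun r := AEEqFun.const Ω ((r : ℝ) : 𝕜)
  map_zero' := by simp only [RCLike.ofReal_zero]; rfl
  map_one' := by simp only [RCLike.ofReal_one]; rfl
  map_add' x y := by simp only [RCLike.ofReal_add]; rfl
  map_mul' x y := by simp only [RCLike.ofReal_mul]; rfl

theorem realToL0_apply (𝕜 : Type*) [RCLike 𝕜] (r : ℝ) :
    realToL0 𝕜 P r = AEEqFun.const Ω ((r : ℝ) : 𝕜) := rfl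

end L0

/-! ### The `(ε, λ)`-topology as convergence in probability; uniqueness of integrals -/

namespace RNModule

variable (𝕜 : Type*) [RCLike 𝕜] {Ω : Type*} [MeasurableSpace Ω] (P : Measure Ω)
  {S : Type*} [AddCommGroup S] [Module (Ω →ₘ[P] 𝕜) S] [RNModule 𝕜 P S]

theorem ae_l0norm_nonneg (x : S) : ∀ᵐ ω ∂P, 0 ≤ (l0norm 𝕜 (P := P) x : Ω →ₘ[P] ℝ) ω := by
  filter_upwards [AEEqFun.coeFn_le.2 (l0norm_nonneg (𝕜 := 𝕜) (P := P) x),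
    AEEqFun.coeFn_zero (μ := P) (α := Ω) (β := ℝ)] with ω h1 h2
  rwa [h2] at h1

theorem ae_l0norm_zero : ∀ᵐ ω ∂P, (l0norm 𝕜 (P := P) (0 : S) : Ω →ₘ[P] ℝ) ω = 0 := by
  rw [l0norm_zero]
  exact AEEqFun.coeFn_zero

theorem ae_l0norm_add_le (x y : S) : ∀ᵐ ω ∂P, (l0norm 𝕜 (P := P) (x + y) : Ω →ₘ[P] ℝ) ω ≤
    (l0norm 𝕜 (P := P) x : Ω →ₘ[P] ℝ) ω + (l0norm 𝕜 (P := P) y : Ω →ₘ[P] ℝ) ω := by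
  filter_upwards [AEEqFun.coeFn_le.2 (l0norm_add_le (𝕜 := 𝕜) (P := P) x y),
    AEEqFun.coeFn_add (l0norm 𝕜 (P := P) x) (l0norm 𝕜 (P := P) y)] with ω h1 h2
  rwa [h2] at h1

theorem l0norm_sub_rev (x y : S) : l0norm 𝕜 (P := P) (x - y) = l0norm 𝕜 (P := P) (y - x) := by
  rw [← l0norm_neg, neg_sub]

theorem ae_abs_l0norm_sub_le (x y : S) : ∀ᵐ ω ∂P, |(l0norm 𝕜 (P := P) x : Ω →ₘ[P] ℝ) ω -
    (l0norm 𝕜 (P := P) y : Ω →ₘ[P] ℝ) ω| ≤ (l0norm 𝕜 (P := P) (x - y) : Ω →ₘ[P] ℝ) ω := by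
  have h1 := ae_l0norm_add_le 𝕜 P (x - y) y
  have h2 := ae_l0norm_add_le 𝕜 P (y - x) x
  rw [sub_add_cancel] at h1 h2
  rw [← l0norm_sub_rev] at h2
  filter_upwards [h1, h2] with ω h1 h2
  rw [abs_le]
  constructor <;> linarith

theorem ae_l0norm_smul (ζ : Ω →ₘ[P] 𝕜) (x : S) : ∀ᵐ ω ∂P,
    (l0norm 𝕜 (P := P) (ζ • x) : Ω →ₘ[P] ℝ) ω =
      ‖ζ ω‖ * (l0norm 𝕜 (P := P) x : Ω →ₘ[P] ℝ) ω := by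
  rw [l0norm_smul]
  filter_upwards [AEEqFun.coeFn_mul (L0abs ζ) (l0norm 𝕜 (P := P) x), coeFn_L0abs ζ] with ω h1 h2
  rw [h1, Pi.mul_apply, h2]

theorem ae_l0norm_realToL0_smul (r : ℝ) (x : S) : ∀ᵐ ω ∂P,
    (l0norm 𝕜 (P := P) (realToL0 𝕜 P r • x) : Ω →ₘ[P] ℝ) ω =
      |r| * (l0norm 𝕜 (P := P) x : Ω →ₘ[P] ℝ) ω := by
  filter_upwards [ae_l0norm_smul 𝕜 P (realToL0 𝕜 P r) x,
    AEEqFun.coeFn_const Ω (μ := P) ((r : ℝ) : 𝕜)] with ω h1 h2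
  rw [h1, realToL0_apply, h2, Function.const_apply, RCLike.norm_ofReal]

theorem measurable_l0norm (x : S) : Measurable (l0norm 𝕜 (P := P) x : Ω →ₘ[P] ℝ) :=
  (l0norm 𝕜 (P := P) x).measurable

/-- Riemann sums see only the tags, which are at least `a`. The integrands compared later agree only
for `s ≥ 0`. -/
theorem HasRiemannIntegral.congr {g g' : ℝ → S} {a b : ℝ} {I : S}
    (h : HasRiemannIntegral 𝕜 P g a b I) (hg : ∀ s, a ≤ s → g s = g' s) :
    HasRiemannIntegral 𝕜 P g' a b I := by
  intro ε lam hε hl hl1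
  obtain ⟨δ, hδ, H⟩ := h ε lam hε hl hl1
  refine ⟨δ, hδ, fun π hπ => ?_⟩
  have : riemannSum 𝕜 P π g' = riemannSum 𝕜 P π g :=
    Finset.sum_congr rfl fun i hi => by rw [hg _ (π.left_le_tag (Finset.mem_range.1 hi))]
  rw [this]
  exact H π hπ

variable [IsProbabilityMeasure P]

/-- Bounding the exceptional event is the form suited to union bounds and Markov's inequality. -/
theorem mem_nhd_iff {x : S} {ε lam : ℝ} : x ∈ nhd 𝕜 P S ε lam ↔
    P.real {ω | ε ≤ (l0norm 𝕜 (P := P) x : Ω →ₘ[P] ℝ) ω} < lam := by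
  have hm : MeasurableSet {ω | (l0norm 𝕜 (P := P) x : Ω →ₘ[P] ℝ) ω < ε} :=
    measurableSet_lt (measurable_l0norm 𝕜 P x) measurable_const
  have hc : {ω | ε ≤ (l0norm 𝕜 (P := P) x : Ω →ₘ[P] ℝ) ω} =
      {ω | (l0norm 𝕜 (P := P) x : Ω →ₘ[P] ℝ) ω < ε}ᶜ := by ext; simp
  rw [hc, probReal_compl_eq_one_sub hm]
  change 1 - lam < _ ↔ _
  constructor <;> intro h <;> linarith

theorem neg_mem_nhd {x : S} {ε lam : ℝ} (hx : x ∈ nhd 𝕜 P S ε lam) : -x ∈ nhd 𝕜 P S ε lam := by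
  rw [mem_nhd_iff] at hx ⊢
  rwa [l0norm_neg]

theorem add_mem_nhd {x y : S} {ε lam : ℝ} (hx : x ∈ nhd 𝕜 P S (ε / 2) (lam / 2))
    (hy : y ∈ nhd 𝕜 P S (ε / 2) (lam / 2)) : x + y ∈ nhd 𝕜 P S ε lam := by
  rw [mem_nhd_iff] at hx hy ⊢
  have hle : P.real {ω | ε ≤ (l0norm 𝕜 (P := P) (x + y) : Ω →ₘ[P] ℝ) ω} ≤
      P.real ({ω | ε / 2 ≤ (l0norm 𝕜 (P := P) x : Ω →ₘ[P] ℝ) ω} ∪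
        {ω | ε / 2 ≤ (l0norm 𝕜 (P := P) y : Ω →ₘ[P] ℝ) ω}) := by
    refine ENNReal.toReal_mono (measure_ne_top _ _) (measure_mono_ae ?_)
    filter_upwards [ae_l0norm_add_le 𝕜 P x y] with ω h1 h2
    have h2' : ε ≤ (l0norm 𝕜 (P := P) (x + y) : Ω →ₘ[P] ℝ) ω := h2
    by_contra h3
    have h3' : ¬ (ε / 2 ≤ (l0norm 𝕜 (P := P) x : Ω →ₘ[P] ℝ) ω ∨
      ε / 2 ≤ (l0norm 𝕜 (P := P) y : Ω →ₘ[P] ℝ) ω) := h3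
    rw [not_or] at h3'
    linarith [h3'.1, h3'.2]
  linarith [measureReal_union_le (μ := P) {ω | ε / 2 ≤ (l0norm 𝕜 (P := P) x : Ω →ₘ[P] ℝ) ω}
    {ω | ε / 2 ≤ (l0norm 𝕜 (P := P) y : Ω →ₘ[P] ℝ) ω}]

/-- The `(ε, λ)`-topology is Hausdorff. -/
theorem eq_of_forall_sub_mem_nhd {x y : S}
    (h : ∀ ε lam : ℝ, 0 < ε → 0 < lam → lam < 1 → x - y ∈ nhd 𝕜 P S ε lam) : x = y := by
  refine sub_eq_zero.1 (eq_zero_of_l0norm_eq_zero (𝕜 := 𝕜) (P := P) _ ?_)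
  have hz : ∀ n : ℕ, ∀ᵐ ω ∂P, (l0norm 𝕜 (P := P) (x - y) : Ω →ₘ[P] ℝ) ω < 1 / ((n : ℝ) + 1) := by
    intro n
    have h0 : P.real {ω | 1 / ((n : ℝ) + 1) ≤
        (l0norm 𝕜 (P := P) (x - y) : Ω →ₘ[P] ℝ) ω} = 0 := by
      refine le_antisymm (le_of_forall_pos_le_add fun δ hδ => ?_) measureReal_nonneg
      -- The minimum with `1 / 2` keeps `λ` below 1.
      have := (mem_nhd_iff 𝕜 P).1 (h (1 / ((n : ℝ) + 1)) (min δ (1 / 2)) (by positivity)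
        (by positivity) ((min_le_right _ _).trans_lt (by norm_num)))
      linarith [min_le_left δ (1 / 2)]
    rw [measureReal_eq_zero_iff] at h0
    rw [ae_iff]
    simpa only [not_lt] using h0
  apply AEEqFun.ext
  filter_upwards [ae_all_iff.2 hz, ae_l0norm_nonneg 𝕜 P (x - y),
    AEEqFun.coeFn_zero (μ := P) (α := Ω) (β := ℝ)] with ω h1 h2 h3
  rw [h3, Pi.zero_apply]
  exact le_antisymm (ge_of_tendsto tendsto_one_div_add_atTop_nhds_zero_nat
    (Eventually.of_forall fun n => (h1 n).le)) h2

theorem tendsto_epsLam_iff {ι : Type*} {l : Filter ι} {u : ι → S} {x : S} :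
    Tendsto u l (@nhds S (epsLamTopology 𝕜 P S) x) ↔ ∀ ε lam : ℝ, 0 < ε → 0 < lam → lam < 1 →
      ∀ᶠ i in l, u i - x ∈ nhd 𝕜 P S ε lam := by
  rw [((basis 𝕜 P S).nhds_hasBasis x).tendsto_right_iff]
  constructor
  · intro h ε lam hε hl hl1
    filter_upwards [h (nhd 𝕜 P S ε lam) ⟨ε, lam, hε, hl, hl1, rfl⟩] with i hi
    obtain ⟨y, hy, hyi⟩ := hi
    rw [← hyi]
    simpa using hy
  · rintro h _ ⟨ε, lam, hε, hl, hl1, rfl⟩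
    filter_upwards [h ε lam hε hl hl1] with i hi
    exact ⟨_, hi, by simp⟩

theorem exists_tendsto_of_epsLamComplete (hS : EpsLamComplete 𝕜 P S) {u : ℕ → S}
    (hu : ∀ ε lam : ℝ, 0 < ε → 0 < lam → lam < 1 →
      ∃ N, ∀ m ≥ N, ∀ n ≥ N, u m - u n ∈ nhd 𝕜 P S ε lam) :
    ∃ x, Tendsto u atTop (@nhds S (epsLamTopology 𝕜 P S) x) := by
  let _ : UniformSpace S := epsLamUniformSpace 𝕜 P S
  have : CompleteSpace S := hS
  refine cauchySeq_tendsto_of_complete (u := u) ?_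
  rw [cauchySeq_iff_tendsto]
  -- The uniformity is the pullback of the neighbourhoods of 0 under the difference map.
  change Tendsto _ _ (comap (fun p : S × S => p.2 + -p.1) (@nhds S (epsLamTopology 𝕜 P S) 0))
  rw [tendsto_comap_iff, tendsto_epsLam_iff]
  intro ε lam hε hl hl1
  obtain ⟨N, hN⟩ := hu ε lam hε hl hl1
  filter_upwards [eventually_ge_atTop ((N, N) : ℕ × ℕ)] with p hp
  simpa [← sub_eq_add_neg] using hN p.2 hp.2 p.1 hp.1

/-- A sequence converging in the `(ε, λ)`-topology has an almost surely converging subsequence. -/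
theorem exists_seq_ae_tendsto_l0norm {u : ℕ → S} {x : S}
    (h : Tendsto u atTop (@nhds S (epsLamTopology 𝕜 P S) x)) :
    ∃ ns : ℕ → ℕ, StrictMono ns ∧ ∀ᵐ ω ∂P,
      Tendsto (fun i => (l0norm 𝕜 (P := P) (u (ns i) - x) : Ω →ₘ[P] ℝ) ω) atTop (𝓝 0) := by
  refine TendstoInMeasure.exists_seq_tendsto_ae
    (f := fun n => (l0norm 𝕜 (P := P) (u n - x) : Ω →ₘ[P] ℝ)) (g := fun _ => 0) ?_
  rw [tendstoInMeasure_iff_measureReal_norm]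
  intro ε hε
  rw [tendsto_epsLam_iff] at h
  rw [Metric.tendsto_nhds]
  intro δ hδ
  filter_upwards [h ε (min δ (1 / 2)) hε (by positivity)
    ((min_le_right _ _).trans_lt (by norm_num))] with n hn
  rw [mem_nhd_iff] at hn
  have heq : P.real {ω | ε ≤ ‖(l0norm 𝕜 (P := P) (u n - x) : Ω →ₘ[P] ℝ) ω - 0‖} =
      P.real {ω | ε ≤ (l0norm 𝕜 (P := P) (u n - x) : Ω →ₘ[P] ℝ) ω} := by
    refine measureReal_congr ?_
    filter_upwards [ae_l0norm_nonneg 𝕜 P (u n - x)] with ω hω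
    refine propext ?_
    change ε ≤ ‖_‖ ↔ ε ≤ _
    rw [sub_zero, Real.norm_of_nonneg hω]
  rw [heq, Real.dist_eq, sub_zero, abs_of_nonneg measureReal_nonneg]
  exact hn.trans_le (min_le_left _ _)

/-- The condition `a ≤ b` provides fine partitions; for `b < a` there are none and every `I` would
be an integral. -/
theorem HasRiemannIntegral.unique {g : ℝ → S} {a b : ℝ} (hab : a ≤ b) {I I' : S}
    (h : HasRiemannIntegral 𝕜 P g a b I) (h' : HasRiemannIntegral 𝕜 P g a b I') : I = I' := by
  refine eq_of_forall_sub_mem_nhd 𝕜 P fun ε lam hε hl hl1 => ?_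
  obtain ⟨δ, hδ, H⟩ := h (ε / 2) (lam / 2) (by linarith) (by linarith) (by linarith)
  obtain ⟨δ', hδ', H'⟩ := h' (ε / 2) (lam / 2) (by linarith) (by linarith) (by linarith)
  obtain ⟨π, hπ⟩ := TaggedPartition.exists_mesh_lt hab (lt_min hδ hδ')
  have := add_mem_nhd 𝕜 P (neg_mem_nhd 𝕜 P (H π fun i hi => (hπ i hi).trans_le (min_le_left _ _)))
    (H' π fun i hi => (hπ i hi).trans_le (min_le_right _ _))
  rwa [neg_sub, sub_add_sub_cancel] at this

theorem HasImproperIntegral.unique {g : ℝ → S} {I I' : S}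
    (h : HasImproperIntegral 𝕜 P g I) (h' : HasImproperIntegral 𝕜 P g I') : I = I' := by
  obtain ⟨J, hJ, hJI⟩ := h
  obtain ⟨J', hJ', hJI'⟩ := h'
  rw [tendsto_epsLam_iff] at hJI hJI'
  refine eq_of_forall_sub_mem_nhd 𝕜 P fun ε lam hε hl hl1 => ?_
  obtain ⟨L, h1, h2, h3⟩ := ((hJI (ε / 2) (lam / 2) (by linarith) (by linarith) (by linarith)).and
    ((hJI' (ε / 2) (lam / 2) (by linarith) (by linarith) (by linarith)).and
      (eventually_ge_atTop 0))).exists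
  rw [(hJ' L h3).unique 𝕜 P h3 (hJ L h3)] at h2
  have := add_mem_nhd 𝕜 P (neg_mem_nhd 𝕜 P h1) h2
  rwa [neg_sub, sub_add_sub_cancel] at this

/-- Once existence is known, neither the choice of the limit nor the default value 0 matters. -/
theorem HasImproperIntegral.improperIntegral_eq {g : ℝ → S} {I : S}
    (h : HasImproperIntegral 𝕜 P g I) : improperIntegral 𝕜 P g = I := by
  have H : ∃ I, HasImproperIntegral 𝕜 P g I := ⟨I, h⟩
  rw [improperIntegral, dif_pos H]
  exact H.choose_spec.unique 𝕜 P h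

end RNModule

/-! ### The Banach space of elements with integrable weighted norm -/

namespace RNModule

variable (𝕜 : Type*) [RCLike 𝕜] {Ω : Type*} [MeasurableSpace Ω] {P : Measure Ω}

/-- The strictly positive weight `(1 + |M|)⁻¹`. -/
noncomputable def weight (M : Ω →ₘ[P] ℝ) (ω : Ω) : ℝ := (1 + |M ω|)⁻¹

theorem weight_pos (M : Ω →ₘ[P] ℝ) (ω : Ω) : 0 < weight M ω :=
  inv_pos.2 (by positivity)

theorem measurable_weight (M : Ω →ₘ[P] ℝ) : Measurable (weight M) :=
  (measurable_const.add M.measurable.abs).inv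

theorem weight_mul_le_one (M : Ω →ₘ[P] ℝ) {ω : Ω} {x : ℝ} (hx : x ≤ M ω) : weight M ω * x ≤ 1 := by
  rw [weight, inv_mul_le_iff₀ (by positivity)]
  linarith [le_abs_self (M ω)]

variable (S : Type*) [AddCommGroup S] [Module (Ω →ₘ[P] 𝕜) S] [RNModule 𝕜 P S]

/-- The elements of `S` whose `L⁰`-norm is integrable against the weight `(1 + |M|)⁻¹`. -/
def weightedL1 (M : Ω →ₘ[P] ℝ) : AddSubgroup S where
  carrier := {x | Integrable (fun ω => weight M ω * (l0norm 𝕜 (P := P) x : Ω →ₘ[P] ℝ) ω) P}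
  zero_mem' := (integrable_zero Ω ℝ P).congr <| by
    filter_upwards [ae_l0norm_zero 𝕜 P (S := S)] with ω h
    simp [h]
  add_mem' := fun {x y} hx hy => (hx.add hy).mono'
    ((measurable_weight M).mul (measurable_l0norm 𝕜 P _)).aestronglyMeasurable <| by
      filter_upwards [ae_l0norm_add_le 𝕜 P x y, ae_l0norm_nonneg 𝕜 P (x + y)] with ω h1 h2
      rw [Real.norm_of_nonneg (mul_nonneg (weight_pos M ω).le h2), Pi.add_apply, ← mul_add]
      exact mul_le_mul_of_nonneg_left h1 (weight_pos M ω).le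
  neg_mem' := fun {x} hx => by
    change Integrable _ P
    rw [l0norm_neg]
    exact hx

variable {S} {M : Ω →ₘ[P] ℝ}

theorem mem_weightedL1_of_le [IsFiniteMeasure P] {x : S} {C : ℝ}
    (h : ∀ᵐ ω ∂P, weight M ω * (l0norm 𝕜 (P := P) x : Ω →ₘ[P] ℝ) ω ≤ C) :
    x ∈ weightedL1 𝕜 S M := by
  refine Integrable.mono' (integrable_const C)
    ((measurable_weight M).mul (measurable_l0norm 𝕜 P _)).aestronglyMeasurable ?_
  filter_upwards [h, ae_l0norm_nonneg 𝕜 P x] with ω h1 h2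
  rwa [Real.norm_of_nonneg (mul_nonneg (weight_pos M ω).le h2)]

theorem realToL0_smul_mem_weightedL1 (r : ℝ) {x : S} (hx : x ∈ weightedL1 𝕜 S M) :
    realToL0 𝕜 P r • x ∈ weightedL1 𝕜 S M := by
  refine (Integrable.const_mul hx |r|).congr ?_
  filter_upwards [ae_l0norm_realToL0_smul 𝕜 P r x] with ω h
  rw [h]
  ring

/-- Multiplication by a general element of `L⁰` need not preserve weighted integrability; real
constants do, and the kernels `e^{-cs}` are real. -/
noncomputable instance : Module ℝ (weightedL1 𝕜 S M) where
  smul r x := ⟨realToL0 𝕜 P r • (x : S), realToL0_smul_mem_weightedL1 𝕜 r x.2⟩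
  one_smul x := Subtype.ext <| by
    change realToL0 𝕜 P 1 • (x : S) = x
    rw [map_one, one_smul]
  mul_smul r r' x := Subtype.ext <| by
    change realToL0 𝕜 P (r * r') • (x : S) = realToL0 𝕜 P r • realToL0 𝕜 P r' • (x : S)
    rw [map_mul, mul_smul]
  smul_zero r := Subtype.ext <| smul_zero (realToL0 𝕜 P r)
  smul_add r x y := Subtype.ext <| smul_add (realToL0 𝕜 P r) (x : S) y
  add_smul r r' x := Subtype.ext <| by
    change realToL0 𝕜 P (r + r') • (x : S) = realToL0 𝕜 P r • (x : S) + realToL0 𝕜 P r' • (x : S)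
    rw [map_add, add_smul]
  zero_smul x := Subtype.ext <| by
    change realToL0 𝕜 P 0 • (x : S) = 0
    rw [map_zero]
    exact zero_smul (Ω →ₘ[P] 𝕜) (x : S)

theorem coe_real_smul (r : ℝ) (x : weightedL1 𝕜 S M) :
    ((r • x : weightedL1 𝕜 S M) : S) = realToL0 𝕜 P r • (x : S) := rfl

noncomputable instance : NormedAddCommGroup (weightedL1 𝕜 S M) :=
  AddGroupNorm.toNormedAddCommGroup
    { toFun x := ∫ ω, weight M ω * (l0norm 𝕜 (P := P) (x : S) : Ω →ₘ[P] ℝ) ω ∂P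
      map_zero' := by
        rw [integral_eq_zero_of_ae]
        filter_upwards [ae_l0norm_zero 𝕜 P (S := S)] with ω h
        simp [h]
      add_le' x y := by
        rw [← integral_add x.2 y.2]
        refine integral_mono_ae (x + y).2 (x.2.add y.2) ?_
        filter_upwards [ae_l0norm_add_le 𝕜 P (x : S) y] with ω h
        rw [← mul_add]
        exact mul_le_mul_of_nonneg_left h (weight_pos M ω).le
      neg' x := by rw [AddSubgroup.coe_neg, l0norm_neg]
      eq_zero_of_map_eq_zero' x hx := by
        have hnn : 0 ≤ᵐ[P] fun ω => weight M ω * (l0norm 𝕜 (P := P) (x : S) : Ω →ₘ[P] ℝ) ω := by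
          filter_upwards [ae_l0norm_nonneg 𝕜 P (x : S)] with ω h
          exact mul_nonneg (weight_pos M ω).le h
        have h0 := (integral_eq_zero_iff_of_nonneg_ae hnn x.2).1 hx
        refine Subtype.ext (eq_zero_of_l0norm_eq_zero (𝕜 := 𝕜) (P := P) _ (AEEqFun.ext ?_))
        filter_upwards [h0, AEEqFun.coeFn_zero (μ := P) (α := Ω) (β := ℝ)] with ω h1 h2
        rw [h2]
        exact (mul_eq_zero.1 h1).resolve_left (weight_pos M ω).ne' }

theorem weightedL1_norm_def (x : weightedL1 𝕜 S M) :
    ‖x‖ = ∫ ω, weight M ω * (l0norm 𝕜 (P := P) (x : S) : Ω →ₘ[P] ℝ) ω ∂P := rfl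

noncomputable instance : NormedSpace ℝ (weightedL1 𝕜 S M) where
  norm_smul_le r x := by
    rw [weightedL1_norm_def, weightedL1_norm_def, Real.norm_eq_abs, ← integral_const_mul]
    refine (integral_congr_ae ?_).le
    filter_upwards [ae_l0norm_realToL0_smul 𝕜 P r (x : S)] with ω h
    rw [coe_real_smul, h]
    ring

theorem weightedL1_norm_le [IsProbabilityMeasure P] (x : weightedL1 𝕜 S M) {C : ℝ}
    (h : ∀ᵐ ω ∂P, weight M ω * (l0norm 𝕜 (P := P) (x : S) : Ω →ₘ[P] ℝ) ω ≤ C) : ‖x‖ ≤ C := by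
  have := integral_mono_ae x.2 (integrable_const C) h
  simpa [weightedL1_norm_def] using this

/-- Fatou's lemma for the weighted `L¹`-norm. -/
theorem weightedL1_norm_le_of_ae_tendsto {u : ℕ → weightedL1 𝕜 S M} {x : S}
    (hx : ∀ᵐ ω ∂P, Tendsto (fun i => (l0norm 𝕜 (P := P) ((u i : S) - x) : Ω →ₘ[P] ℝ) ω) atTop
      (𝓝 0)) {C : ℝ} (hC : 0 ≤ C) (hu : ∀ i, ‖u i‖ ≤ C) :
    ∃ hx : x ∈ weightedL1 𝕜 S M, ‖(⟨x, hx⟩ : weightedL1 𝕜 S M)‖ ≤ C := by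
  have hmeas : ∀ y : S, Measurable
      fun ω => weight M ω * (l0norm 𝕜 (P := P) y : Ω →ₘ[P] ℝ) ω :=
    fun y => (measurable_weight M).mul (measurable_l0norm 𝕜 P y)
  have hnn : ∀ y : S,
      0 ≤ᵐ[P] fun ω => weight M ω * (l0norm 𝕜 (P := P) y : Ω →ₘ[P] ℝ) ω := fun y => by
    filter_upwards [ae_l0norm_nonneg 𝕜 P y] with ω h
    exact mul_nonneg (weight_pos M ω).le h
  have hlim : ∀ᵐ ω ∂P, Tendsto
      (fun i => ENNReal.ofReal (weight M ω * (l0norm 𝕜 (P := P) (u i : S) : Ω →ₘ[P] ℝ) ω)) atTop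
      (𝓝 (ENNReal.ofReal (weight M ω * (l0norm 𝕜 (P := P) x : Ω →ₘ[P] ℝ) ω))) := by
    filter_upwards [hx, ae_all_iff.2 fun i => ae_abs_l0norm_sub_le 𝕜 P (u i : S) x] with ω h1 h2
    refine (ENNReal.continuous_ofReal.tendsto _).comp (Tendsto.const_mul _ ?_)
    rw [tendsto_iff_norm_sub_tendsto_zero]
    exact squeeze_zero (fun _ => norm_nonneg _) h2 h1
  -- Fatou is applied to lower integrals because the integrability of the limit is not yet known.
  have hle : ∫⁻ ω, ENNReal.ofReal (weight M ω * (l0norm 𝕜 (P := P) x : Ω →ₘ[P] ℝ) ω) ∂P ≤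
      ENNReal.ofReal C := by
    calc _ = ∫⁻ ω, liminf (fun i => ENNReal.ofReal
            (weight M ω * (l0norm 𝕜 (P := P) (u i : S) : Ω →ₘ[P] ℝ) ω)) atTop ∂P :=
          lintegral_congr_ae (by filter_upwards [hlim] with ω h using h.liminf_eq.symm)
      _ ≤ liminf (fun i => ∫⁻ ω, ENNReal.ofReal
            (weight M ω * (l0norm 𝕜 (P := P) (u i : S) : Ω →ₘ[P] ℝ) ω) ∂P) atTop :=
          lintegral_liminf_le fun i => (hmeas _).ennreal_ofReal
      _ ≤ ENNReal.ofReal C := by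
          refine liminf_le_of_frequently_le' (Eventually.of_forall fun i => ?_).frequently
          rw [← ofReal_integral_eq_lintegral_ofReal (u i).2 (hnn _)]
          exact ENNReal.ofReal_le_ofReal (hu i)
  have hint : x ∈ weightedL1 𝕜 S M :=
    (lintegral_ofReal_ne_top_iff_integrable (hmeas x).aestronglyMeasurable (hnn x)).1
      (hle.trans_lt ENNReal.ofReal_lt_top).ne
  refine ⟨hint, ?_⟩
  rw [← ofReal_integral_eq_lintegral_ofReal hint (hnn _)] at hle
  exact (ENNReal.ofReal_le_ofReal_iff hC).1 hle

variable [IsProbabilityMeasure P]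

/-- Convergence in the weighted `L¹`-norm implies convergence in the `(ε, λ)`-topology. -/
theorem exists_forall_norm_lt_mem_nhd (M : Ω →ₘ[P] ℝ) {ε lam : ℝ} (hε : 0 < ε) (hl : 0 < lam) :
    ∃ δ > 0, ∀ x : weightedL1 𝕜 S M, ‖x‖ < δ → (x : S) ∈ nhd 𝕜 P S ε lam := by
  -- The weight is positive but may have no positive lower bound. The events where it is below `1 /
  -- (n + 1)` decrease to `∅`, so one of them has probability below `λ / 2`.
  have hlim : Tendsto (fun n : ℕ => P.real {ω | weight M ω < 1 / ((n : ℝ) + 1)}) atTop (𝓝 0) := by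
    have hanti : Antitone fun n : ℕ => {ω | weight M ω < 1 / ((n : ℝ) + 1)} :=
      fun m n hmn ω (hω : weight M ω < 1 / ((n : ℝ) + 1)) =>
        show weight M ω < 1 / ((m : ℝ) + 1) from hω.trans_le (Nat.one_div_le_one_div hmn)
    have hempty : ⋂ n : ℕ, {ω | weight M ω < 1 / ((n : ℝ) + 1)} = ∅ := by
      refine Set.eq_empty_of_forall_notMem fun ω hω => ?_
      obtain ⟨n, hn⟩ := exists_nat_one_div_lt (weight_pos M ω)
      exact lt_asymm hn (Set.mem_iInter.1 hω n)
    have := tendsto_measure_iInter_atTop (μ := P)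
      (s := fun n : ℕ => {ω | weight M ω < 1 / ((n : ℝ) + 1)})
      (fun n => (measurableSet_lt (measurable_weight M) measurable_const).nullMeasurableSet)
      hanti ⟨0, measure_ne_top _ _⟩
    rw [hempty, measure_empty] at this
    exact (ENNReal.tendsto_toReal ENNReal.zero_ne_top).comp this
  obtain ⟨n, hn⟩ := (hlim.eventually_lt_const (half_pos hl)).exists
  set c : ℝ := 1 / ((n : ℝ) + 1) with hc
  have hc0 : 0 < c := by positivity
  -- Where the weight is at least `c`, `‖x‖ ≥ ε` forces the weighted norm to be at least `c ε`;
  -- Markov bounds this event by `λ / 2`.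
  refine ⟨c * ε * (lam / 2), by positivity, fun x hx => ?_⟩
  rw [mem_nhd_iff]
  have hnn : 0 ≤ᵐ[P] fun ω => weight M ω * (l0norm 𝕜 (P := P) (x : S) : Ω →ₘ[P] ℝ) ω := by
    filter_upwards [ae_l0norm_nonneg 𝕜 P (x : S)] with ω h
    exact mul_nonneg (weight_pos M ω).le h
  have hmarkov := mul_meas_ge_le_integral_of_nonneg hnn x.2 (c * ε)
  have hsub : {ω | ε ≤ (l0norm 𝕜 (P := P) (x : S) : Ω →ₘ[P] ℝ) ω} ⊆ {ω | weight M ω < c} ∪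
      {ω | c * ε ≤ weight M ω * (l0norm 𝕜 (P := P) (x : S) : Ω →ₘ[P] ℝ) ω} := by
    intro ω hω
    rcases lt_or_ge (weight M ω) c with h | h
    · exact Or.inl h
    · exact Or.inr (mul_le_mul h hω hε.le (weight_pos M ω).le)
  have hP : P.real {ω | c * ε ≤ weight M ω * (l0norm 𝕜 (P := P) (x : S) : Ω →ₘ[P] ℝ) ω} <
      lam / 2 := lt_of_mul_lt_mul_left (hmarkov.trans_lt hx) (by positivity)
  linarith [(measureReal_mono (μ := P) hsub).trans (measureReal_union_le _ _)]

theorem tendsto_coe_epsLam {ι : Type*} {l : Filter ι} {u : ι → weightedL1 𝕜 S M}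
    {x : weightedL1 𝕜 S M} (h : Tendsto u l (𝓝 x)) :
    Tendsto (fun i => (u i : S)) l (@nhds S (epsLamTopology 𝕜 P S) x) := by
  rw [tendsto_epsLam_iff]
  intro ε lam hε hl _
  obtain ⟨δ, hδ, H⟩ := exists_forall_norm_lt_mem_nhd 𝕜 (S := S) M hε hl
  filter_upwards [Metric.tendsto_nhds.1 h δ hδ] with i hi
  rw [dist_eq_norm] at hi
  exact H _ hi

/-- A norm Cauchy sequence is Cauchy in `S`, so it has a limit there, almost surely along a
subsequence. Fatou applied to `u m - u (ns i)` turns this into norm convergence. -/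
theorem completeSpace_weightedL1 (hS : EpsLamComplete 𝕜 P S) (M : Ω →ₘ[P] ℝ) :
    CompleteSpace (weightedL1 𝕜 S M) := by
  refine Metric.complete_of_cauchySeq_tendsto fun u hu => ?_
  obtain ⟨x, hx⟩ := exists_tendsto_of_epsLamComplete 𝕜 P hS (u := fun n => (u n : S)) (by
    intro ε lam hε hl _
    obtain ⟨δ, hδ, H⟩ := exists_forall_norm_lt_mem_nhd 𝕜 (S := S) M hε hl
    obtain ⟨N, hN⟩ := Metric.cauchySeq_iff.1 hu δ hδ
    refine ⟨N, fun m hm n hn => ?_⟩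
    have h := hN m hm n hn
    rw [dist_eq_norm] at h
    exact H _ h)
  obtain ⟨ns, hns, hae⟩ := exists_seq_ae_tendsto_l0norm 𝕜 P hx
  have key : ∀ ε > 0, ∃ N, ∀ m ≥ N, ∃ h : (u m : S) - x ∈ weightedL1 𝕜 S M,
      ‖(⟨_, h⟩ : weightedL1 𝕜 S M)‖ ≤ ε := by
    intro ε hε
    obtain ⟨N, hN⟩ := Metric.cauchySeq_iff.1 hu ε hε
    refine ⟨N, fun m hm => ?_⟩
    -- The shift by `N` ensures `ns (i + N) ≥ N`, within the Cauchy range.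
    refine weightedL1_norm_le_of_ae_tendsto 𝕜 (u := fun i => u m - u (ns (i + N))) ?_ hε.le
      fun i => ?_
    · filter_upwards [hae] with ω h
      refine ((tendsto_add_atTop_iff_nat N).2 h).congr fun i => ?_
      rw [AddSubgroup.coe_sub, sub_sub_sub_cancel_left, l0norm_sub_rev]
    · rw [← dist_eq_norm]
      exact (hN m hm _ ((Nat.le_add_left N i).trans (hns.id_le _))).le
  obtain ⟨N, hN⟩ := key 1 one_pos
  obtain ⟨h, -⟩ := hN N le_rfl
  have hmem : x ∈ weightedL1 𝕜 S M := by
    have := (weightedL1 𝕜 S M).sub_mem (u N).2 h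
    rwa [sub_sub_cancel] at this
  refine ⟨⟨x, hmem⟩, Metric.tendsto_atTop.2 fun ε hε => ?_⟩
  obtain ⟨N, hN⟩ := key (ε / 2) (half_pos hε)
  refine ⟨N, fun n hn => ?_⟩
  obtain ⟨h, hle⟩ := hN n hn
  rw [dist_eq_norm]
  exact lt_of_le_of_lt hle (half_lt_self hε)

end RNModule

/-! ### Damped functions and their Laplace transforms -/

namespace RNModule

variable (𝕜 : Type*) [RCLike 𝕜] {Ω : Type*} [MeasurableSpace Ω] {P : Measure Ω}
  {S : Type*} [AddCommGroup S] [Module (Ω →ₘ[P] 𝕜) S] [RNModule 𝕜 P S]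
  {M ξ : Ω →ₘ[P] ℝ}

theorem riemannSum_coe {a b : ℝ} (π : TaggedPartition a b) (v : ℝ → weightedL1 𝕜 S M) :
    riemannSum 𝕜 P π (fun s => (v s : S)) =
      ((∑ i ∈ Finset.range π.n, (π.pt (i + 1) - π.pt i) • v (π.tag i) : weightedL1 𝕜 S M) : S) := by
  rw [AddSubgroup.val_finsetSum]
  rfl

theorem ae_l0norm_L0exp_neg_smul_le {x : S} {s : ℝ}
    (hx : l0norm 𝕜 (P := P) x ≤ M * L0exp ℝ ξ s) :
    ∀ᵐ ω ∂P, (l0norm 𝕜 (P := P) (L0exp 𝕜 (-ξ) s • x) : Ω →ₘ[P] ℝ) ω ≤ M ω := by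
  filter_upwards [AEEqFun.coeFn_le.2 hx, AEEqFun.coeFn_mul M (L0exp ℝ ξ s), coeFn_L0exp ℝ ξ s,
    coeFn_L0exp 𝕜 (-ξ) s, AEEqFun.coeFn_neg ξ, ae_l0norm_smul 𝕜 P (L0exp 𝕜 (-ξ) s) x]
    with ω h1 h2 h3 h4 h5 h6
  rw [h2, Pi.mul_apply, h3] at h1
  rw [h6, h4, h5, RCLike.norm_ofReal, Real.abs_exp, Pi.neg_apply]
  refine (mul_le_mul_of_nonneg_left h1 (Real.exp_pos _).le).trans (le_of_eq ?_)
  rw [mul_left_comm, RCLike.ofReal_real_eq_id, id, ← Real.exp_add]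
  simp

/-- The increment of the exponential falls on `y`, which stays fixed when `x` and `t` vary in
`continuous_damped`. -/
theorem ae_l0norm_L0exp_smul_sub_le (η : Ω →ₘ[P] ℝ) (x y : S) (s t : ℝ) : ∀ᵐ ω ∂P,
    (l0norm 𝕜 (P := P) (L0exp 𝕜 η t • x - L0exp 𝕜 η s • y) : Ω →ₘ[P] ℝ) ω ≤
      Real.exp (η ω * t) * (l0norm 𝕜 (P := P) (x - y) : Ω →ₘ[P] ℝ) ω +
        |Real.exp (η ω * t) - Real.exp (η ω * s)| * (l0norm 𝕜 (P := P) y : Ω →ₘ[P] ℝ) ω := by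
  have hdec : L0exp 𝕜 η t • x - L0exp 𝕜 η s • y =
      L0exp 𝕜 η t • (x - y) + (L0exp 𝕜 η t - L0exp 𝕜 η s) • y := by
    rw [smul_sub, sub_smul]
    abel
  rw [hdec]
  filter_upwards [ae_l0norm_add_le 𝕜 P (L0exp 𝕜 η t • (x - y)) ((L0exp 𝕜 η t - L0exp 𝕜 η s) • y),
    ae_l0norm_smul 𝕜 P (L0exp 𝕜 η t) (x - y), ae_l0norm_smul 𝕜 P (L0exp 𝕜 η t - L0exp 𝕜 η s) y,
    coeFn_L0exp 𝕜 η t, coeFn_L0exp 𝕜 η s, AEEqFun.coeFn_sub (L0exp 𝕜 η t) (L0exp 𝕜 η s)]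
    with ω h1 h2 h3 h4 h5 h6
  have h6' : (L0exp 𝕜 η t - L0exp 𝕜 η s : Ω →ₘ[P] 𝕜) ω = L0exp 𝕜 η t ω - L0exp 𝕜 η s ω := h6
  refine h1.trans (le_of_eq ?_)
  rw [h2, h3, h6', h4, h5, ← RCLike.ofReal_sub, RCLike.norm_ofReal, RCLike.norm_ofReal,
    Real.abs_exp]

variable [IsProbabilityMeasure P]

theorem hasRiemannIntegral_coe [CompleteSpace (weightedL1 𝕜 S M)] {v : ℝ → weightedL1 𝕜 S M}
    (hv : Continuous v) {a b : ℝ} (hab : a ≤ b) :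
    HasRiemannIntegral 𝕜 P (fun s => (v s : S)) a b
      ((∫ s in a..b, v s : weightedL1 𝕜 S M) : S) := by
  intro ε lam hε hl _
  obtain ⟨δ, hδ, H⟩ := exists_forall_norm_lt_mem_nhd 𝕜 (S := S) M hε hl
  obtain ⟨δ', hδ', H'⟩ := exists_forall_norm_riemannSum_sub_integral_lt hv hab hδ
  refine ⟨δ', hδ', fun π hπ => ?_⟩
  rw [riemannSum_coe, ← AddSubgroup.coe_sub]
  exact H _ (H' π hπ)

theorem hasImproperIntegral_coe [CompleteSpace (weightedL1 𝕜 S M)] {v : ℝ → weightedL1 𝕜 S M}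
    (hv : Continuous v) (hi : IntegrableOn v (Set.Ioi 0)) {g : ℝ → S}
    (hg : ∀ s, 0 ≤ s → (v s : S) = g s) :
    HasImproperIntegral 𝕜 P g ((∫ s in Set.Ioi (0 : ℝ), v s : weightedL1 𝕜 S M) : S) :=
  ⟨fun L => ((∫ s in (0 : ℝ)..L, v s : weightedL1 𝕜 S M) : S),
    fun _ hL => (hasRiemannIntegral_coe 𝕜 hv hL).congr 𝕜 P hg,
    tendsto_coe_epsLam 𝕜 (intervalIntegral_tendsto_integral_Ioi 0 hi tendsto_id)⟩

/-- The damped function `s ↦ e^{-ξ s} h(s)` with values in the weighted `L¹`-space. -/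
noncomputable def damped (h : ℝ≥0 → S)
    (hb : ∀ s : ℝ≥0, l0norm 𝕜 (P := P) (h s) ≤ M * L0exp ℝ ξ s) (s : ℝ≥0) : weightedL1 𝕜 S M :=
  ⟨L0exp 𝕜 (-ξ) s • h s, mem_weightedL1_of_le 𝕜 (C := 1) <| by
    filter_upwards [ae_l0norm_L0exp_neg_smul_le 𝕜 (hb s)] with ω hω
    exact weight_mul_le_one M hω⟩

theorem norm_damped_le (h : ℝ≥0 → S)
    (hb : ∀ s : ℝ≥0, l0norm 𝕜 (P := P) (h s) ≤ M * L0exp ℝ ξ s) (s : ℝ≥0) :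
    ‖damped 𝕜 h hb s‖ ≤ 1 :=
  weightedL1_norm_le 𝕜 _ <| by
    filter_upwards [ae_l0norm_L0exp_neg_smul_le 𝕜 (hb s)] with ω hω
    exact weight_mul_le_one M hω

/-- Convergence in probability is almost sure only along subsequences, hence the subsequence
criterion, followed by dominated convergence. -/
theorem continuous_damped {h : ℝ≥0 → S} (hc : Continuous[inferInstance, epsLamTopology 𝕜 P S] h)
    (hb : ∀ s : ℝ≥0, l0norm 𝕜 (P := P) (h s) ≤ M * L0exp ℝ ξ s) :
    Continuous (damped 𝕜 h hb) := by
  refine continuous_iff_seqContinuous.2 fun t s hts => tendsto_of_subseq_tendsto fun ns hns => ?_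
  have hh : Tendsto (fun n => h (t (ns n))) atTop (@nhds S (epsLamTopology 𝕜 P S) (h s)) :=
    Tendsto.comp (y := 𝓝 s)
      ((@continuous_iff_continuousAt _ _ _ (epsLamTopology 𝕜 P S) _).1 hc s) (hts.comp hns)
  obtain ⟨ms, hms, hae⟩ := exists_seq_ae_tendsto_l0norm 𝕜 P hh
  refine ⟨ms, ?_⟩
  have ht : Tendsto (fun k => ((t (ns (ms k)) : ℝ≥0) : ℝ)) atTop (𝓝 (s : ℝ)) :=
    (NNReal.continuous_coe.tendsto s).comp (hts.comp (hns.comp hms.tendsto_atTop))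
  rw [tendsto_iff_norm_sub_tendsto_zero]
  simp only [weightedL1_norm_def, Function.comp_apply]
  rw [← integral_zero Ω ℝ (μ := P)]
  -- Each damped value has weighted `L⁰`-norm at most 1, so differences are dominated by 2.
  refine tendsto_integral_of_dominated_convergence (fun _ => 2)
    (fun k => (damped 𝕜 h hb (t (ns (ms k))) - damped 𝕜 h hb s).2.aestronglyMeasurable)
    (integrable_const _) (fun k => ?_) ?_
  · filter_upwards [ae_l0norm_L0exp_neg_smul_le 𝕜 (hb s),
      ae_l0norm_L0exp_neg_smul_le 𝕜 (hb (t (ns (ms k)))),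
      ae_l0norm_nonneg 𝕜 P (damped 𝕜 h hb (t (ns (ms k))) - damped 𝕜 h hb s : S),
      ae_l0norm_add_le 𝕜 P (damped 𝕜 h hb (t (ns (ms k))) : S) (-(damped 𝕜 h hb s : S))]
      with ω h1 h2 h3 h4
    rw [← sub_eq_add_neg, l0norm_neg] at h4
    rw [AddSubgroup.coe_sub, Real.norm_of_nonneg (mul_nonneg (weight_pos M ω).le h3)]
    refine (mul_le_mul_of_nonneg_left h4 (weight_pos M ω).le).trans ?_
    rw [mul_add]
    have h5 := weight_mul_le_one M h1
    have h6 := weight_mul_le_one M h2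
    change weight M ω * (l0norm 𝕜 (P := P) (L0exp 𝕜 (-ξ) _ • h _) : Ω →ₘ[P] ℝ) ω +
      weight M ω * (l0norm 𝕜 (P := P) (L0exp 𝕜 (-ξ) _ • h _) : Ω →ₘ[P] ℝ) ω ≤ 2
    linarith
  · filter_upwards [hae, ae_all_iff.2 fun k => ae_l0norm_L0exp_smul_sub_le 𝕜 (-ξ)
      (h (t (ns (ms k)))) (h s) (s : ℝ) (t (ns (ms k)) : ℝ), ae_all_iff.2 fun k =>
      ae_l0norm_nonneg 𝕜 P (damped 𝕜 h hb (t (ns (ms k))) - damped 𝕜 h hb s : S)] with ω h1 h2 h3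
    have hexp : Tendsto (fun k => Real.exp ((-ξ : Ω →ₘ[P] ℝ) ω * (t (ns (ms k)) : ℝ))) atTop
        (𝓝 (Real.exp ((-ξ : Ω →ₘ[P] ℝ) ω * s))) :=
      (Real.continuous_exp.tendsto _).comp (ht.const_mul _)
    have hlim := (hexp.mul h1).add ((hexp.sub_const (Real.exp ((-ξ : Ω →ₘ[P] ℝ) ω * s))).abs.mul_const
      ((l0norm 𝕜 (P := P) (h s) : Ω →ₘ[P] ℝ) ω))
    rw [sub_self, abs_zero, zero_mul, mul_zero, add_zero] at hlim
    have := (squeeze_zero h3 h2 hlim).const_mul (weight M ω)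
    rwa [mul_zero] at this

/-- At `η = ξ + c` the Laplace transform is a Bochner integral in the weighted `L¹`-space. -/
theorem laplaceTransform_add_const [CompleteSpace (weightedL1 𝕜 S M)] {h : ℝ≥0 → S}
    (hc : Continuous[inferInstance, epsLamTopology 𝕜 P S] h)
    (hb : ∀ s : ℝ≥0, l0norm 𝕜 (P := P) (h s) ≤ M * L0exp ℝ ξ s) {c : ℝ} (hc0 : 0 < c) :
    laplaceTransform 𝕜 P h (ξ + AEEqFun.const Ω c) = ((∫ s in Set.Ioi (0 : ℝ),
      Real.exp (-(c * s)) • damped 𝕜 h hb s.toNNReal : weightedL1 𝕜 S M) : S) := by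
  have hcont : Continuous fun s : ℝ => damped 𝕜 h hb s.toNNReal :=
    (continuous_damped 𝕜 hc hb).comp continuous_real_toNNReal
  refine (hasImproperIntegral_coe 𝕜 (by fun_prop) (integrableOn_exp_smul_of_bounded hcont
    (fun s => norm_damped_le 𝕜 h hb _) hc0) fun s hs => ?_).improperIntegral_eq 𝕜 P
  change realToL0 𝕜 P (Real.exp (-(c * s))) • L0exp 𝕜 (-ξ) (s.toNNReal : ℝ) • h s.toNNReal = _
  rw [Real.coe_toNNReal s hs, smul_smul, realToL0_apply, L0exp_neg_add_const]

/-- The damped difference is merely bounded; the factor `e^{-s}` makes it integrable and turns its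
moment of order `k` into the difference of the transforms at `ξ + (k + 1)`. -/
theorem eq_of_laplaceTransform_add_const_eq (hS : EpsLamComplete 𝕜 P S) {h₁ h₂ : ℝ≥0 → S}
    (hc₁ : Continuous[inferInstance, epsLamTopology 𝕜 P S] h₁)
    (hc₂ : Continuous[inferInstance, epsLamTopology 𝕜 P S] h₂)
    (hb₁ : ∀ s : ℝ≥0, l0norm 𝕜 (P := P) (h₁ s) ≤ M * L0exp ℝ ξ s)
    (hb₂ : ∀ s : ℝ≥0, l0norm 𝕜 (P := P) (h₂ s) ≤ M * L0exp ℝ ξ s)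
    (hL : ∀ c : ℝ, 0 < c → laplaceTransform 𝕜 P h₁ (ξ + AEEqFun.const Ω c) =
      laplaceTransform 𝕜 P h₂ (ξ + AEEqFun.const Ω c)) : h₁ = h₂ := by
  have := completeSpace_weightedL1 𝕜 hS M
  have hcont₁ : Continuous fun s : ℝ => damped 𝕜 h₁ hb₁ s.toNNReal :=
    (continuous_damped 𝕜 hc₁ hb₁).comp continuous_real_toNNReal
  have hcont₂ : Continuous fun s : ℝ => damped 𝕜 h₂ hb₂ s.toNNReal :=
    (continuous_damped 𝕜 hc₂ hb₂).comp continuous_real_toNNReal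
  have hint₁ : ∀ c : ℝ, 0 < c → IntegrableOn
      (fun s => Real.exp (-(c * s)) • damped 𝕜 h₁ hb₁ s.toNNReal) (Set.Ioi 0) := fun c hc =>
    integrableOn_exp_smul_of_bounded hcont₁ (fun s => norm_damped_le 𝕜 h₁ hb₁ _) hc
  have hint₂ : ∀ c : ℝ, 0 < c → IntegrableOn
      (fun s => Real.exp (-(c * s)) • damped 𝕜 h₂ hb₂ s.toNNReal) (Set.Ioi 0) := fun c hc =>
    integrableOn_exp_smul_of_bounded hcont₂ (fun s => norm_damped_le 𝕜 h₂ hb₂ _) hc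
  have hzero : ∀ s : ℝ, 0 ≤ s → Real.exp (-(1 * s)) • damped 𝕜 h₁ hb₁ s.toNNReal -
      Real.exp (-(1 * s)) • damped 𝕜 h₂ hb₂ s.toNNReal = 0 := by
    intro s hs
    refine eq_zero_of_forall_integral_exp_smul_eq_zero
      (F := fun s => Real.exp (-(1 * s)) • damped 𝕜 h₁ hb₁ s.toNNReal -
        Real.exp (-(1 * s)) • damped 𝕜 h₂ hb₂ s.toNNReal) (by fun_prop)
      ((hint₁ 1 one_pos).sub (hint₂ 1 one_pos)) (fun k => ?_) hs
    have hk : (0 : ℝ) < k + 1 := by positivity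
    have hexp : ∀ s : ℝ, Real.exp (-s) ^ k * Real.exp (-(1 * s)) =
        Real.exp (-(((k : ℝ) + 1) * s)) := fun s => by
      rw [← Real.exp_nat_mul, ← Real.exp_add]
      congr 1
      ring
    simp only [smul_sub, smul_smul, hexp]
    rw [integral_sub (hint₁ _ hk) (hint₂ _ hk), sub_eq_zero]
    apply Subtype.ext
    rw [← laplaceTransform_add_const 𝕜 hc₁ hb₁ hk, ← laplaceTransform_add_const 𝕜 hc₂ hb₂ hk,
      hL _ hk]
  funext s
  have h := hzero s s.2
  rw [← smul_sub, smul_eq_zero, or_iff_right (Real.exp_pos _).ne', sub_eq_zero,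
    Real.toNNReal_coe] at h
  have h' : L0exp 𝕜 (-ξ) s • h₁ s = L0exp 𝕜 (-ξ) s • h₂ s := congrArg Subtype.val h
  have h'' := congrArg (L0exp 𝕜 ξ (s : ℝ) • ·) h'
  simpa only [smul_smul, L0exp_mul_L0exp_neg, one_smul] using h''

end RNModule

theorem mul_L0exp_mono {Ω : Type*} [MeasurableSpace Ω] {P : Measure Ω} {M M' ξ ξ' : Ω →ₘ[P] ℝ}
    (hM : 0 ≤ M') (hMM' : M ≤ M') (hξ : ξ ≤ ξ') (s : ℝ≥0) :
    M * L0exp ℝ ξ s ≤ M' * L0exp ℝ ξ' s := by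
  rw [← AEEqFun.coeFn_le]
  filter_upwards [AEEqFun.coeFn_le.2 hM, AEEqFun.coeFn_le.2 hMM', AEEqFun.coeFn_le.2 hξ,
    AEEqFun.coeFn_mul M (L0exp ℝ ξ s), AEEqFun.coeFn_mul M' (L0exp ℝ ξ' s), coeFn_L0exp ℝ ξ s,
    coeFn_L0exp ℝ ξ' s, AEEqFun.coeFn_zero (μ := P) (α := Ω) (β := ℝ)] with ω h1 h2 h3 h4 h5 h6 h7 h8
  rw [h8] at h1
  rw [h4, h5, Pi.mul_apply, Pi.mul_apply, h6, h7]
  exact mul_le_mul h2 (Real.exp_le_exp.2 (mul_le_mul_of_nonneg_right h3 s.2))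
    (Real.exp_pos _).le h1

theorem L0_le_add_of_nonneg {Ω : Type*} [MeasurableSpace Ω] {P : Measure Ω} (M : Ω →ₘ[P] ℝ)
    {M' : Ω →ₘ[P] ℝ} (hM : 0 ≤ M') : M ≤ M + M' := by
  rw [← AEEqFun.coeFn_le]
  filter_upwards [AEEqFun.coeFn_le.2 hM, AEEqFun.coeFn_add M M',
    AEEqFun.coeFn_zero (μ := P) (α := Ω) (β := ℝ)] with ω h1 h2 h3
  rw [h3] at h1
  rw [h2, Pi.add_apply]
  exact le_add_of_nonneg_right h1

theorem corollary3p6 {𝕜 : Type*} [RCLike 𝕜] {Ω : Type*} [MeasurableSpace Ω]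
    (P : Measure Ω) [IsProbabilityMeasure P]
    {S : Type*} [AddCommGroup S] [Module (Ω →ₘ[P] 𝕜) S] [RNModule 𝕜 P S]
    (hS : RNModule.EpsLamComplete 𝕜 P S)
    (h₁ h₂ : ℝ≥0 → S)
    (hc₁ : Continuous[inferInstance, RNModule.epsLamTopology 𝕜 P S] h₁)
    (hc₂ : Continuous[inferInstance, RNModule.epsLamTopology 𝕜 P S] h₂)
    (M₁ M₂ ξ₁ ξ₂ : Ω →ₘ[P] ℝ) (hM₁ : 0 ≤ M₁) (hM₂ : 0 ≤ M₂)
    (hb₁ : ∀ s : ℝ≥0, RNModule.l0norm 𝕜 (P := P) (h₁ s) ≤ M₁ * L0exp ℝ ξ₁ s)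
    (hb₂ : ∀ s : ℝ≥0, RNModule.l0norm 𝕜 (P := P) (h₂ s) ≤ M₂ * L0exp ℝ ξ₂ s)
    (hL : ∀ η : Ω →ₘ[P] ℝ, (∀ᵐ ω ∂P, (ξ₁ ⊔ ξ₂ : Ω →ₘ[P] ℝ) ω < η ω) →
      RNModule.laplaceTransform 𝕜 P h₁ η = RNModule.laplaceTransform 𝕜 P h₂ η) :
    h₁ = h₂ := by
  have hM : M₁ ≤ M₁ + M₂ := L0_le_add_of_nonneg M₁ hM₂
  have hM' : M₂ ≤ M₁ + M₂ := add_comm M₂ M₁ ▸ L0_le_add_of_nonneg M₂ hM₁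
  -- A common bound places both damped functions in the same weighted space, and `ξ₁ ⊔ ξ₂ + c` with
  -- `c > 0` is an admissible `η`.
  refine RNModule.eq_of_laplaceTransform_add_const_eq 𝕜 (M := M₁ + M₂) (ξ := ξ₁ ⊔ ξ₂) hS hc₁ hc₂
    (fun s => (hb₁ s).trans (mul_L0exp_mono (hM₁.trans hM) hM le_sup_left s))
    (fun s => (hb₂ s).trans (mul_L0exp_mono (hM₁.trans hM) hM' le_sup_right s))
    fun c hc => hL _ ?_
  filter_upwards [AEEqFun.coeFn_add (ξ₁ ⊔ ξ₂) (AEEqFun.const Ω c),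
    AEEqFun.coeFn_const Ω (μ := P) c] with ω h1 h2
  rw [h1, Pi.add_apply, h2]
  exact lt_add_of_pos_right _ hc
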